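/- A mixed graph $G$ is obtained from a finite simple graph (the underlying graph of $G$) by orienting some, possibly none or all, of its edges. Its Hermitian adjacency matrix $H(G)=(h_{uv})$ has $h_{uv}=i$ if there is an edge oriented from $u$ to $v$, $h_{uv}=-i$ if there is an edge oriented from $v$ to $u$, $h_{uv}=1$ if $u$ and $v$ are joined by an unoriented edge, and $h_{uv}=0$ otherwise. Its Hermitian quasi-Laplacian is $Q_H=D(G)+H(G)$, where $D(G)$ is the diagonal matrix of the vertex degrees in the underlying graph. $G$ is called quapartite if its vertex set can be partitioned into four (possibly empty) sets $V_1,V_2,V_3,V_4$ such that every unoriented edge is between $V_1$ and $V_3$ or between $V_2$ and $V_4$, and every oriented edge is from $V_1$ to $V_2$, from $V_2$ to $V_3$, from $V_3$ to $V_4$, or from $V_4$ to $V_1$. Corollary. Let $G$ be a mixed graph that is not quapartite, and let $v$ be a vertex of $G$ such that the mixed graph $G\setminus v$, obtained by deleting $v$ and all edges at $v$, is quapartite. Let $Q_H(v)$ be the matrix obtained from $Q_H=Q_H(G)$ by deleting the row and the column indexed by $v$. Then $|\det(Q_H(v))|$ equals the number of spanning trees of (the underlying graph of) $G$. -/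

import Mathlib

/-- A (simple) mixed graph on `V`: an unoriented simple graph `underlying`, a subset of whose edges
has been oriented. `arc u v` says that the edge `uv` is oriented from `u` to `v`. -/
structure MixedGraph (V : Type*) where
  /-- the underlying unoriented graph -/
  underlying : SimpleGraph V
  /-- the oriented edges -/
  arc : V → V → Prop
  arc_adj : ∀ u v, arc u v → underlying.Adj u v
  arc_asymm : ∀ u v, arc u v → ¬ arc v u

namespace MixedGraph

/-- `u` and `v` are joined by an edge that has not been oriented. -/
def Unoriented {V : Type*} (G : MixedGraph V) (u v : V) : Prop :=
  G.underlying.Adj u v ∧ ¬ G.arc u v ∧ ¬ G.arc v u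

/-- The mixed graph obtained by deleting the vertex `v` and all edges at `v`. -/
def deleteVertex {V : Type*} (G : MixedGraph V) (v : V) : MixedGraph {w : V // w ≠ v} where
  underlying := G.underlying.comap Subtype.val
  arc := fun a b => G.arc a.1 b.1
  arc_adj := fun a b h => G.arc_adj a.1 b.1 h
  arc_asymm := fun a b h => G.arc_asymm a.1 b.1 h

/-- `G` is quapartite: the vertices can be distributed into four (possibly empty) classes
`V₁, V₂, V₃, V₄` (`P w` is the class of `w`, the classes being indexed by `0, 1, 2, 3`), so that every
unoriented edge is between `V₁` and `V₃` or between `V₂` and `V₄`, and every oriented edge is from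
`V₁` to `V₂`, from `V₂` to `V₃`, from `V₃` to `V₄` or from `V₄` to `V₁`. -/
def Quapartite {V : Type*} (G : MixedGraph V) : Prop :=
  ∃ P : V → Fin 4,
    (∀ u v, G.Unoriented u v →
      (P u = 0 ∧ P v = 2) ∨ (P u = 2 ∧ P v = 0) ∨ (P u = 1 ∧ P v = 3) ∨ (P u = 3 ∧ P v = 1)) ∧
    (∀ u v, G.arc u v →
      (P u = 0 ∧ P v = 1) ∨ (P u = 1 ∧ P v = 2) ∨ (P u = 2 ∧ P v = 3) ∨ (P u = 3 ∧ P v = 0))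

open Classical in
/-- The Hermitian adjacency matrix. -/
noncomputable def hermitianAdj {V : Type*} (G : MixedGraph V) : Matrix V V ℂ :=
  Matrix.of fun u v =>
    if G.arc u v then Complex.I
    else if G.arc v u then -Complex.I
    else if G.Unoriented u v then 1
    else 0

open Classical in
/-- The diagonal matrix of the vertex degrees of the underlying graph. -/
noncomputable def degreeMatrix {V : Type*} [Fintype V] (G : MixedGraph V) : Matrix V V ℂ :=
  Matrix.diagonal fun u => (G.underlying.degree u : ℂ)

/-- The Hermitian quasi-Laplacian matrix `Q_H = D + H`. -/
noncomputable def quasiLaplacian {V : Type*} [Fintype V] (G : MixedGraph V) : Matrix V V ℂ :=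
  G.degreeMatrix + G.hermitianAdj

/-- The number of spanning trees of `G`, i.e. of its underlying graph: subgraphs with the full
vertex set `V` that are trees. -/
noncomputable def numSpanningTrees {V : Type*} (G : MixedGraph V) : ℕ :=
  Set.ncard {T : SimpleGraph V | T ≤ G.underlying ∧ T.IsTree}

end MixedGraph

/-- The matrix `A(v)` obtained from `A` by deleting row `v` and column `v`. -/
def Matrix.deleteRowCol {V R : Type*} (A : Matrix V V R) (v : V) :
    Matrix {w : V // w ≠ v} {w : V // w ≠ v} R :=
  A.submatrix Subtype.val Subtype.val

/-!
The class function `P` of a quapartition of `G ∖ v` is a switching: conjugating `Q_H(v)` by the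
diagonal unitary matrix with entries `i ^ P u` turns every nonzero off-diagonal entry into `-1`
(`MixedGraph.deleteRowCol_quasiLaplacian_eq`), so `Q_H(v)` has the determinant of the reduced
Laplacian `L(v)` of the underlying graph of `G`. What remains is the matrix-tree theorem
(`SimpleGraph.det_deleteRowCol_lapMatrix`).

For the latter, row `u` of `L(v)` is the sum, over the neighbours `w` of `u`, of `e_u - e_w`, where
`e_v = 0`. Expanding the determinant along all rows gives a sum over all maps `f` sending each vertex
`u ≠ v` to one of its neighbours; the summand is the determinant of the matrix `1 - N`, where `N` is
the `0`-`1` matrix of `f`. If the step relation of `f` is well-founded, i.e. if iterating `f` leads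
from every vertex to `v`, then `1 - N` is unitriangular for the rank function of that relation, and
its determinant is `1`. Otherwise the indicator of the vertices that never arrive at `v` is a
nonzero kernel vector, and the determinant is `0`. Finally, sending `f` to the set of edges
`u — f u` is a bijection from the well-founded maps to the spanning trees: the inverse orients a
tree towards `v`.
-/

/-! ### Parent maps -/

/-- A map `f` defined away from `v` is regarded as a parent map, `f u` being the parent of `u`.
`IsParent f a u` says that `u ≠ v` and that `a` is the parent of `u`. The parent map describes a
tree rooted at `v` exactly when this relation is well-founded. -/
def IsParent {V : Type*} {v : V} (f : {w : V // w ≠ v} → V) (a u : V) : Prop :=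
  ∃ h : u ≠ v, f ⟨u, h⟩ = a

/-- The matrix, with rows and columns indexed by the vertices other than `v`, whose row `u` is
`e_u - e_{f u}`, where `e_v` is read as `0`. -/
def parentMatrix {V : Type*} [DecidableEq V] (R : Type*) [Ring R] {v : V}
    (f : {w : V // w ≠ v} → V) : Matrix {w : V // w ≠ v} {w : V // w ≠ v} R :=
  Matrix.of fun u x => (if u = x then 1 else 0) - (if f u = x.1 then 1 else 0)

theorem isParent_apply {V : Type*} {v : V} (f : {w : V // w ≠ v} → V) (u : {w : V // w ≠ v}) :
    IsParent f (f u) u.1 :=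
  ⟨u.2, rfl⟩

theorem acc_isParent_root {V : Type*} {v : V} (f : {w : V // w ≠ v} → V) :
    Acc (IsParent f) v :=
  ⟨_, fun _ ⟨h, _⟩ => absurd rfl h⟩

theorem acc_isParent_iff {V : Type*} {v : V} (f : {w : V // w ≠ v} → V) (u : {w : V // w ≠ v}) :
    Acc (IsParent f) u.1 ↔ Acc (IsParent f) (f u) := by
  refine ⟨fun h => h.inv (isParent_apply f u), fun h => ⟨_, ?_⟩⟩
  rintro _ ⟨_, rfl⟩
  exact h

theorem det_parentMatrix_of_wellFounded {V : Type*} [Fintype V] [DecidableEq V] {R : Type*}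
    [CommRing R] {v : V} {f : {w : V // w ≠ v} → V} (hf : WellFounded (IsParent f)) :
    (parentMatrix R f).det = 1 := by
  classical
  have : IsWellFounded V (IsParent f) := ⟨hf⟩
  have hlt (u : {w : V // w ≠ v}) :
      IsWellFounded.rank (IsParent f) (f u) < IsWellFounded.rank (IsParent f) u.1 :=
    IsWellFounded.rank_lt_of_rel (isParent_apply f u)
  -- Parents have smaller rank, so the matrix is upper triangular for the reversed rank.
  let b : {w : V // w ≠ v} → Ordinalᵒᵈ := fun u =>
    OrderDual.toDual (IsWellFounded.rank (IsParent f) u.1)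
  have hb : (parentMatrix R f).BlockTriangular b := by
    intro i j hij
    have h1 : i ≠ j := by rintro rfl; exact lt_irrefl _ hij
    have h2 : f i ≠ j.1 := by
      intro h
      have := hlt i
      rw [h] at this
      exact lt_asymm this hij
    simp [parentMatrix, h1, h2]
  rw [hb.det]
  refine Finset.prod_eq_one fun a _ => ?_
  -- A vertex and its parent lie in different blocks.
  have : (parentMatrix R f).toSquareBlock b a = 1 := by
    ext i j
    have h2 : f i.1 ≠ j.1.1 := by
      intro h
      have h3 := hlt i.1
      rw [h] at h3
      exact h3.ne (congrArg OrderDual.ofDual (j.2.trans i.2.symm))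
    simp [Matrix.toSquareBlock_def, parentMatrix, h2, Matrix.one_apply, Subtype.ext_iff]
  rw [this, Matrix.det_one]

theorem det_parentMatrix_of_not_wellFounded {V : Type*} [Fintype V] [DecidableEq V] {R : Type*}
    [CommRing R] {v : V} {f : {w : V // w ≠ v} → V} (hf : ¬ WellFounded (IsParent f)) :
    (parentMatrix R f).det = 0 := by
  classical
  obtain ⟨u, hu⟩ : ∃ u, ¬ Acc (IsParent f) u := by
    by_contra! h
    exact hf ⟨h⟩
  have huv : u ≠ v := by
    rintro rfl
    exact hu (acc_isParent_root f)
  let x : {w : V // w ≠ v} → R := fun w => if Acc (IsParent f) w.1 then 0 else 1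
  have hx : (parentMatrix R f).mulVec x = 0 := by
    ext i
    have h1 : ∑ j : {w : V // w ≠ v}, (if f i = j.1 then x j else 0)
        = if Acc (IsParent f) (f i) then 0 else 1 := by
      by_cases hv : f i = v
      · rw [hv, if_pos (acc_isParent_root f)]
        exact Finset.sum_eq_zero fun j _ => if_neg j.2.symm
      · rw [Finset.sum_eq_single ⟨f i, hv⟩]
        · simp [x]
        · intro j _ hj
          exact if_neg fun h => hj (Subtype.ext h.symm)
        · simp
    simp only [Matrix.mulVec, dotProduct, parentMatrix, Matrix.of_apply, sub_mul, ite_mul, one_mul,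
      zero_mul, Finset.sum_sub_distrib, h1, Finset.sum_ite_eq, Finset.mem_univ, if_true,
      Pi.zero_apply, x, acc_isParent_iff f i, sub_self]
  have h : (parentMatrix R f).det • x = 0 := by
    rw [← Matrix.one_mulVec x, ← Matrix.smul_mulVec, ← Matrix.adjugate_mul,
      ← Matrix.mulVec_mulVec, hx, Matrix.mulVec_zero]
  simpa [x, hu] using congrFun h ⟨u, huv⟩

/-! ### Spanning trees -/

namespace SimpleGraph

/-- The graph whose edges join each vertex other than `v` to its parent. -/
def ofParent {V : Type*} {v : V} (f : {w : V // w ≠ v} → V) : SimpleGraph V :=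
  SimpleGraph.fromRel (IsParent f)

theorem ofParent_le {V : Type*} {v : V} {f : {w : V // w ≠ v} → V} {G : SimpleGraph V}
    (h : ∀ u, G.Adj u.1 (f u)) : ofParent f ≤ G := by
  intro a b hab
  obtain ⟨_, ⟨hb, rfl⟩ | ⟨ha, rfl⟩⟩ := hab
  · exact (h ⟨b, hb⟩).symm
  · exact h ⟨a, ha⟩

theorem ofParent_adj {V : Type*} {v : V} {f : {w : V // w ≠ v} → V}
    (hf : WellFounded (IsParent f)) (u : {w : V // w ≠ v}) : (ofParent f).Adj u.1 (f u) := by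
  refine ⟨fun h => ?_, Or.inr (isParent_apply f u)⟩
  have := isParent_apply f u
  rw [← h] at this
  exact hf.irrefl.irrefl _ this

theorem connected_ofParent {V : Type*} {v : V} {f : {w : V // w ≠ v} → V}
    (hf : WellFounded (IsParent f)) : (ofParent f).Connected := by
  have h (u : V) : (ofParent f).Reachable u v := by
    induction u using hf.induction with
    | _ u ih =>
      by_cases hu : u = v
      · rw [hu]
      · exact (ofParent_adj hf ⟨u, hu⟩).reachable.trans (ih _ (isParent_apply f ⟨u, hu⟩))
  exact { preconnected := fun a b => (h a).trans (h b).symm, nonempty := ⟨v⟩ }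

theorem isTree_ofParent {V : Type*} [Finite V] {v : V} {f : {w : V // w ≠ v} → V}
    (hf : WellFounded (IsParent f)) : (ofParent f).IsTree := by
  classical
  have := Fintype.ofFinite V
  have hc := connected_ofParent hf
  refine isTree_iff_connected_and_card.2
    ⟨hc, le_antisymm ?_ hc.card_vert_le_card_edgeSet_add_one⟩
  -- Every edge is the edge from some vertex other than `v` to its parent.
  let e : {w : V // w ≠ v} → (ofParent f).edgeSet := fun u => ⟨s(u.1, f u), ofParent_adj hf u⟩
  have he : Function.Surjective e := by
    rintro ⟨x, hx⟩
    induction x using Sym2.ind with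
    | _ a b =>
      obtain ⟨_, ⟨hb, h⟩ | ⟨ha, h⟩⟩ := id hx
      · exact ⟨⟨b, hb⟩, Subtype.ext ((congrArg (fun w => s(b, w)) h).trans Sym2.eq_swap)⟩
      · exact ⟨⟨a, ha⟩, Subtype.ext (congrArg (fun w => s(a, w)) h)⟩
  have h1 := Nat.card_le_card_of_surjective e he
  have h2 : Nat.card {w : V // w ≠ v} + 1 = Nat.card V := by
    have : 0 < Fintype.card V := Fintype.card_pos_iff.2 ⟨v⟩
    simp only [Nat.card_eq_fintype_card, ne_eq, Fintype.card_subtype_compl,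
      Fintype.card_subtype_eq]
    omega
  omega

/-- A tree determines its parent map towards a given root. -/
theorem ofParent_injOn {V : Type*} (v : V) :
    Set.InjOn ofParent {f : {w : V // w ≠ v} → V | WellFounded (IsParent f)} := by
  intro f hf g hg hfg
  have key (u : V) : ∀ hu : u ≠ v, g ⟨u, hu⟩ = f ⟨u, hu⟩ := by
    induction u using (show WellFounded (IsParent f) from hf).induction with
    | _ u ih =>
      intro hu
      have hadj := ofParent_adj hf ⟨u, hu⟩
      rw [hfg] at hadj
      obtain ⟨_, ⟨hw, h⟩ | ⟨_, h⟩⟩ := hadj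
      · -- Here `u` would be the parent of its own parent.
        rw [ih _ (isParent_apply f ⟨u, hu⟩) hw] at h
        exact absurd ⟨hw, h⟩ (hf.asymmetric _ _ (isParent_apply f ⟨u, hu⟩))
      · exact h
  exact funext fun u => (key u.1 u.2).symm

/-- Each tree arises from the map that moves every vertex one step closer to the root. -/
theorem IsTree.exists_ofParent_eq {V : Type*} {T : SimpleGraph V} (hT : T.IsTree) (v : V) :
    ∃ f : {w : V // w ≠ v} → V,
      WellFounded (IsParent f) ∧ (∀ u, T.Adj u.1 (f u)) ∧ ofParent f = T := by
  have h (u : {w : V // w ≠ v}) : ∃ w, T.Adj u.1 w ∧ T.dist w v < T.dist u.1 v := by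
    obtain ⟨u, hu⟩ := u
    obtain ⟨p, hp⟩ := hT.connected.exists_walk_length_eq_dist u v
    cases p with
    | nil => exact absurd rfl hu
    | cons hadj q =>
      refine ⟨_, hadj, (dist_le q).trans_lt ?_⟩
      rw [← hp, Walk.length_cons]
      exact Nat.lt_succ_self _
  choose f hadj hlt using h
  have hf : WellFounded (IsParent f) := by
    refine Subrelation.wf ?_ (measure fun u => T.dist u v).wf
    rintro _ u ⟨hu, rfl⟩
    exact hlt ⟨u, hu⟩
  have hle := ofParent_le hadj
  exact ⟨f, hf, hadj, le_antisymm hle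
    ((isTree_iff_minimal_connected.1 hT).le_of_le (connected_ofParent hf) hle)⟩

theorem ncard_isTree_eq_ncard_parent {V : Type*} [Finite V] (G : SimpleGraph V) (v : V) :
    {T : SimpleGraph V | T ≤ G ∧ T.IsTree}.ncard =
      {f : {w : V // w ≠ v} → V | WellFounded (IsParent f) ∧ ∀ u, G.Adj u.1 (f u)}.ncard := by
  rw [← ((ofParent_injOn v).mono fun f hf => hf.1).ncard_image]
  congr 1
  ext T
  constructor
  · rintro ⟨hle, hT⟩
    obtain ⟨f, hf, hadj, rfl⟩ := hT.exists_ofParent_eq v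
    exact ⟨f, ⟨hf, fun u => hle (hadj u)⟩, rfl⟩
  · rintro ⟨f, ⟨hf, hadj⟩, rfl⟩
    exact ⟨ofParent_le hadj, isTree_ofParent hf⟩

/-! ### The matrix-tree theorem -/

theorem deleteRowCol_lapMatrix_apply {V : Type*} [Fintype V] [DecidableEq V] {R : Type*}
    [CommRing R] (G : SimpleGraph V) [DecidableRel G.Adj] (v : V) (u x : {w : V // w ≠ v}) :
    (G.lapMatrix R).deleteRowCol v u x =
      ∑ w ∈ G.neighborFinset u.1, ((if u = x then 1 else 0) - (if w = x.1 then 1 else 0)) := by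
  simp [Matrix.deleteRowCol, lapMatrix, degMatrix, Matrix.diagonal_apply, Subtype.ext_iff]

/-- The matrix-tree theorem: every principal minor of the Laplacian of size one less counts the
spanning trees. -/
theorem det_deleteRowCol_lapMatrix {V : Type*} [Fintype V] [DecidableEq V] (R : Type*)
    [CommRing R] (G : SimpleGraph V) [DecidableRel G.Adj] (v : V) :
    ((G.lapMatrix R).deleteRowCol v).det =
      ({T : SimpleGraph V | T ≤ G ∧ T.IsTree}.ncard : R) := by
  classical
  have hrow : (G.lapMatrix R).deleteRowCol v = fun u => ∑ w ∈ G.neighborFinset u.1,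
      fun x : {w : V // w ≠ v} => ((if u = x then 1 else 0) - (if w = x.1 then 1 else 0) : R) := by
    ext u x
    rw [deleteRowCol_lapMatrix_apply, Finset.sum_apply]
  have hdet : ((G.lapMatrix R).deleteRowCol v).det =
      ∑ f ∈ Fintype.piFinset fun u : {w : V // w ≠ v} => G.neighborFinset u.1,
        (parentMatrix R f).det := by
    rw [hrow]
    exact (Matrix.detRowAlternating (R := R) (n := {w : V // w ≠ v})).toMultilinearMap.map_sum_finset
      (fun u w x => (if u = x then 1 else 0) - (if w = x.1 then 1 else 0)) _
  have hterm (f : {w : V // w ≠ v} → V) :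
      (parentMatrix R f).det = if WellFounded (IsParent f) then 1 else 0 := by
    split_ifs with hf
    · exact det_parentMatrix_of_wellFounded hf
    · exact det_parentMatrix_of_not_wellFounded hf
  rw [hdet, ncard_isTree_eq_ncard_parent G v, Finset.sum_congr rfl fun f _ => hterm f,
    Finset.sum_boole, ← Set.ncard_coe_finset]
  congr 2
  ext f
  simp [and_comm]

end SimpleGraph

/-! ### Switching -/

namespace MixedGraph

/-- Deleting a vertex whose removal leaves a quapartite graph makes the quasi-Laplacian
diagonally similar to the reduced Laplacian of the underlying graph. -/
theorem deleteRowCol_quasiLaplacian_eq {V : Type*} [Fintype V] [DecidableEq V]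
    (G : MixedGraph V) [DecidableRel G.underlying.Adj] (v : V) (hv : (G.deleteVertex v).Quapartite) :
    ∃ P : {w : V // w ≠ v} → Fin 4, G.quasiLaplacian.deleteRowCol v =
      Matrix.diagonal (fun u => Complex.I ^ (P u).val) *
        (G.underlying.lapMatrix ℂ).deleteRowCol v *
        Matrix.diagonal (fun u => (-Complex.I) ^ (P u).val) := by
  obtain ⟨P, hun, harc⟩ := hv
  classical
  refine ⟨P, ?_⟩
  ext a b
  rw [Matrix.mul_diagonal, Matrix.diagonal_mul]
  by_cases hab : a = b
  · subst hab
    have h1 : ¬ G.underlying.Adj a.1 a.1 := G.underlying.irrefl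
    have h2 : ¬ G.arc a.1 a.1 := fun h => h1 (G.arc_adj _ _ h)
    have h3 : Complex.I ^ (P a).val * (-Complex.I) ^ (P a).val = 1 := by
      rw [← mul_pow]; simp
    rw [mul_right_comm, h3, one_mul]
    simp [Matrix.deleteRowCol, quasiLaplacian, degreeMatrix, hermitianAdj, Unoriented,
      SimpleGraph.lapMatrix, SimpleGraph.degMatrix, h2]
    -- The two degrees differ only in the instance that makes the neighbour set finite.
    congr!
  · have hne : a.1 ≠ b.1 := fun h => hab (Subtype.ext h)
    have hQ : G.quasiLaplacian.deleteRowCol v a b =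
        if G.arc a.1 b.1 then Complex.I else if G.arc b.1 a.1 then -Complex.I
        else if G.Unoriented a.1 b.1 then 1 else 0 := by
      simp [Matrix.deleteRowCol, quasiLaplacian, degreeMatrix, hermitianAdj, hne]
    have hL : (G.underlying.lapMatrix ℂ).deleteRowCol v a b =
        if G.underlying.Adj a.1 b.1 then -1 else 0 := by
      simp only [Matrix.deleteRowCol, SimpleGraph.lapMatrix, SimpleGraph.degMatrix,
        Matrix.submatrix_apply, Matrix.sub_apply, Matrix.diagonal_apply_ne _ hne,
        SimpleGraph.adjMatrix_apply]
      split_ifs <;> simp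
    rw [hQ, hL]
    by_cases h1 : G.arc a.1 b.1
    · rw [if_pos h1, if_pos (G.arc_adj _ _ h1)]
      rcases harc a b h1 with ⟨ha, hb⟩ | ⟨ha, hb⟩ | ⟨ha, hb⟩ | ⟨ha, hb⟩ <;>
        simp [ha, hb, pow_succ]
    by_cases h2 : G.arc b.1 a.1
    · rw [if_neg h1, if_pos h2, if_pos (G.arc_adj _ _ h2).symm]
      rcases harc b a h2 with ⟨ha, hb⟩ | ⟨ha, hb⟩ | ⟨ha, hb⟩ | ⟨ha, hb⟩ <;>
        simp [ha, hb, pow_succ]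
    by_cases h3 : G.underlying.Adj a.1 b.1
    · rw [if_neg h1, if_neg h2, if_pos ⟨h3, h1, h2⟩, if_pos h3]
      rcases hun a b ⟨h3, h1, h2⟩ with ⟨ha, hb⟩ | ⟨ha, hb⟩ | ⟨ha, hb⟩ | ⟨ha, hb⟩ <;>
        simp [ha, hb, pow_succ]
    · rw [if_neg h1, if_neg h2, if_neg fun h => h3 h.1, if_neg h3]
      simp

end MixedGraph

theorem mainTheorem10 {V : Type*} [Fintype V] [DecidableEq V] (G : MixedGraph V) (v : V)
    (hG : ¬ G.Quapartite) (hv : (G.deleteVertex v).Quapartite) :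
    ‖(G.quasiLaplacian.deleteRowCol v).det‖ = (G.numSpanningTrees : ℝ) := by
  classical
  have hL := SimpleGraph.det_deleteRowCol_lapMatrix ℂ G.underlying v
  obtain ⟨P, hP⟩ := G.deleteRowCol_quasiLaplacian_eq v hv
  have hdet : (G.quasiLaplacian.deleteRowCol v).det = (G.numSpanningTrees : ℂ) := by
    rw [MixedGraph.numSpanningTrees, ← hL, hP, Matrix.det_mul, Matrix.det_mul, mul_right_comm,
      Matrix.det_diagonal, Matrix.det_diagonal, ← Finset.prod_mul_distrib]
    simp only [← mul_pow, mul_neg, Complex.I_mul_I, neg_neg, one_pow, Finset.prod_const_one,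
      one_mul]
  rw [hdet, Complex.norm_natCast]
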